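/- Let $G$ be a compact connected Lie group with Lie algebra $\mathfrak g=T_1G$, let $\cdot$ be an $\mathrm{Ad}$-invariant inner product on $\mathfrak g$, and let $g\ge 0$ be an integer. Let $F$ be the free group on $x_1,\dots,x_{2g}$, let $R=\prod_{i=1}^{g}[x_{2i-1},x_{2i}]\in F$ with $[a,b]=aba^{-1}b^{-1}$, and identify $Y=\mathrm{Hom}(F,G)$ with $G^{2g}$. Let $\epsilon_R:Y\to G$, $\epsilon_R(y)=y(R)=\prod_{i=1}^{g}[y_{2i-1},y_{2i}]$. Let $\alpha,\bar\alpha\in\Omega^1(G)\otimes\mathfrak g$ be the left- and right-invariant Maurer–Cartan forms, $\alpha_g=(dL_{g^{-1}})_g$ and $\bar\alpha_g=(dR_{g^{-1}})_g$ (with $L_{g^{-1}}(h)=g^{-1}h$ and $R_{g^{-1}}(h)=hg^{-1}$), let $\theta_\eta=\eta\cdot(\alpha+\bar\alpha)\in\Omega^1(G)$ for $\eta\in\mathfrak g$, and let $\Omega=\pi_1^*\alpha\cdot\pi_2^*\bar\alpha\in\Omega^2(G^2)$, where $\pi_1,\pi_2:G^2\to G$ are the projections and $(a\cdot b)(u,v)=a(u)\cdot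 b(v)-a(v)\cdot b(u)$ for $\mathfrak g$-valued 1-forms $a,b$. Let $c=\sum_{i=1}^{2g}(\partial R/\partial x_i,\,x_i)$ be the group 2-chain on $F$ in which $\partial/\partial x_i$ is the Fox derivative, and let $$\omega=\langle c,E^*\Omega\rangle\in\Omega^2(Y),$$ that is, if $c=\sum_k n_k(a_k,b_k)$ with $n_k\in\mathbb Z$ and $a_k,b_k\in F$, then $\omega=\sum_k n_k\,E_{a_k,b_k}^*\Omega$ with $E_{a,b}(y)=(y(a),y(b))$. Let $G$ act on $Y$ by conjugation, and for $\eta\in\mathfrak g$ let $\tilde\eta$ be the generated vector field, $\tilde\eta_y=\frac{d}{ds}\big|_{s=0}\exp(s\eta)\cdot y$. Then for every $\eta\in\mathfrak g$ the following identity of 1-forms on $Y=G^{2g}$ holds: $$\iota_{\tilde\eta}\,\omega=\epsilon_R^*\theta_\eta .$$ Hence, for every $t\in G$, the restriction of $\omega$ to the level set $Y_t=\epsilon_R^{-1}(t)$ is horizontal with respect to the conjugation action of the centralizer $Z_t$ of $t$: for every $\eta\in\mathrm{Lie}(Z_t)$ and every $y\in Y_t$, the vector $\tilde\eta_y$ lies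 in the (Zariski) tangent space $T_yY_t=\ker (d\epsilon_R)_y$, and $\omega_y(\tilde\eta_y,v)=0$ for all $v\in T_yY_t$. -/

import Mathlib

open scoped Manifold ContDiff

noncomputable section

namespace FlatModuli

/-! ### Free differential calculus and the distinguished group 2-chain -/

section Chains

variable {ι : Type*} [DecidableEq ι]

/-- The free group acts on its integral group ring (as an additive group) by left multiplication. -/
def foxAction (ι : Type*) :
    FreeGroup ι →* MulAut (Multiplicative (MonoidAlgebra ℤ (FreeGroup ι))) where
  toFun w := AddEquiv.toMultiplicative
    { toFun := fun a => MonoidAlgebra.of ℤ (FreeGroup ι) w * a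
      invFun := fun a => MonoidAlgebra.of ℤ (FreeGroup ι) w⁻¹ * a
      left_inv := fun a => by
        change _ * (_ * a) = a
        rw [← mul_assoc, ← map_mul, inv_mul_cancel, map_one, one_mul]
      right_inv := fun a => by
        change _ * (_ * a) = a
        rw [← mul_assoc, ← map_mul, mul_inv_cancel, map_one, one_mul]
      map_add' := fun a b => mul_add _ a b }
  map_one' := MulEquiv.ext fun a => by
    change MonoidAlgebra.of ℤ (FreeGroup ι) 1 * a.toAdd = a.toAdd
    rw [map_one, one_mul]
  map_mul' v w := MulEquiv.ext fun a => by
    change MonoidAlgebra.of ℤ (FreeGroup ι) (v * w) * a.toAdd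
      = MonoidAlgebra.of ℤ (FreeGroup ι) v * (MonoidAlgebra.of ℤ (FreeGroup ι) w * a.toAdd)
    rw [map_mul, mul_assoc]

/-- The homomorphism `w ↦ (∂w/∂xᵢ, w)` from the free group to the semidirect product of its
group ring with itself, determined by its values on the generators. -/
def foxHom (i : ι) :
    FreeGroup ι →* Multiplicative (MonoidAlgebra ℤ (FreeGroup ι)) ⋊[foxAction ι] FreeGroup ι :=
  FreeGroup.lift fun j => ⟨Multiplicative.ofAdd (if j = i then 1 else 0), FreeGroup.of j⟩

/-- The Fox derivative `∂w/∂xᵢ`, an element of the integral group ring of the free group. -/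
def foxDeriv (i : ι) (w : FreeGroup ι) : MonoidAlgebra ℤ (FreeGroup ι) :=
  (foxHom i w).left.toAdd

theorem foxHom_right (i : ι) (w : FreeGroup ι) : (foxHom i w).right = w := by
  have h : (SemidirectProduct.rightHom.comp (foxHom i)) = MonoidHom.id (FreeGroup ι) := by
    ext j
    simp [foxHom]
  exact DFunLike.congr_fun h w

theorem foxDeriv_of (i j : ι) : foxDeriv i (FreeGroup.of j) = if j = i then 1 else 0 := by
  simp [foxDeriv, foxHom]

theorem foxDeriv_mul (i : ι) (v w : FreeGroup ι) :
    foxDeriv i (v * w) = foxDeriv i v + MonoidAlgebra.of ℤ (FreeGroup ι) v * foxDeriv i w := by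
  simp only [foxDeriv, map_mul, SemidirectProduct.mul_left, foxHom_right]
  rfl

/-- The commutator `[a, b] = a b a⁻¹ b⁻¹`. -/
def groupComm {Γ : Type*} [Group Γ] (a b : Γ) : Γ := a * b * a⁻¹ * b⁻¹

/-- The relator `R = [x₁, x₂] [x₃, x₄] ⋯ [x_{2g-1}, x_{2g}]`, with generators numbered from `0`. -/
def relator (g : ℕ) : FreeGroup (Fin (2 * g)) :=
  (List.ofFn fun i : Fin g =>
    groupComm (FreeGroup.of (⟨2 * i.1, by omega⟩ : Fin (2 * g)))
      (FreeGroup.of (⟨2 * i.1 + 1, by omega⟩ : Fin (2 * g)))).prod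

/-- The group 2-chain `c = ∑ᵢ (∂R/∂xᵢ, xᵢ)`, where `(·, xᵢ)` is extended linearly from group
elements to the integral group ring. -/
def chainC (g : ℕ) : (FreeGroup (Fin (2 * g)) × FreeGroup (Fin (2 * g))) →₀ ℤ :=
  ∑ i : Fin (2 * g),
    (foxDeriv i (relator g)).coeff.mapDomain fun w => (w, FreeGroup.of i)

end Chains

/-! ### The space `Y = Hom(F, G) = G^{2g}` -/

section RepSpace

variable {G : Type*} [Group G]

/-- The space `Y = Hom(F, G)`, identified with `G^{2g}` through the values on the generators. -/
abbrev RepSpace (G : Type*) (g : ℕ) : Type _ := Fin (2 * g) → G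

/-- The value at `w ∈ F` of the homomorphism `F → G` corresponding to `y`. -/
def evalAt {g : ℕ} (w : FreeGroup (Fin (2 * g))) (y : RepSpace G g) : G :=
  FreeGroup.lift y w

/-- The map `ε_R : Y → G`, evaluation at the relator. -/
def epsR {g : ℕ} (y : RepSpace G g) : G := evalAt (relator g) y

theorem epsR_eq {g : ℕ} (y : RepSpace G g) :
    epsR y = (List.ofFn fun i : Fin g =>
      groupComm (y ⟨2 * i.1, by omega⟩) (y ⟨2 * i.1 + 1, by omega⟩)).prod := by
  simp [epsR, evalAt, relator, groupComm, map_list_prod, List.map_ofFn, Function.comp_def]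

/-- The action of `G` on `Y` by conjugation. -/
def conjAct {g : ℕ} (h : G) (y : RepSpace G g) : RepSpace G g := fun i => h * y i * h⁻¹

/-- The level set `Y_t` of `ε_R`. -/
def levelSet (g : ℕ) (t : G) : Set (RepSpace G g) := epsR ⁻¹' {t}

theorem evalAt_conjAct {g : ℕ} (h : G) (w : FreeGroup (Fin (2 * g))) (y : RepSpace G g) :
    evalAt w (conjAct h y) = h * evalAt w y * h⁻¹ := by
  have key : FreeGroup.lift (conjAct h y)
      = (MulAut.conj h).toMonoidHom.comp (FreeGroup.lift y) := by
    ext i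
    simp [conjAct]
  exact DFunLike.congr_fun key w

/-- The centralizer `Z_t` of `t` acts on the level set `Y_t` by conjugation. -/
instance centralizerAction (g : ℕ) (t : G) :
    MulAction (Subgroup.centralizer {t}) (levelSet g t) where
  smul z y := ⟨conjAct z.1 y.1, by
    have hy : evalAt (relator g) y.1 = t := y.2
    have hz := Subgroup.mem_centralizer_singleton_iff.mp z.2
    change evalAt (relator g) (conjAct z.1 y.1) = t
    rw [evalAt_conjAct, hy, hz, mul_inv_cancel_right]⟩
  one_smul y := Subtype.ext <| funext fun i => by
    change 1 * y.1 i * 1⁻¹ = y.1 i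
    simp
  mul_smul z z' y := Subtype.ext <| funext fun i => by
    change (z.1 * z'.1) * y.1 i * (z.1 * z'.1)⁻¹ = z.1 * (z'.1 * y.1 i * z'.1⁻¹) * z.1⁻¹
    group

end RepSpace

/-! ### Differential forms on manifolds, pointwise -/

section Forms

variable {E : Type*} [NormedAddCommGroup E] [NormedSpace ℝ E]
  {H : Type*} [TopologicalSpace H] (I : ModelWithCorners ℝ E H)
  {E' : Type*} [NormedAddCommGroup E'] [NormedSpace ℝ E']
  {H' : Type*} [TopologicalSpace H'] (I' : ModelWithCorners ℝ E' H')
  (M : Type*) [TopologicalSpace M] [ChartedSpace H M]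
  {N : Type*} [TopologicalSpace N] [ChartedSpace H' N]
  {V : Type*} [AddCommGroup V] [Module ℝ V]

/-- `V`-valued `q`-forms on a manifold: an alternating `q`-linear map on each tangent space. -/
abbrev DForm (V : Type*) [AddCommGroup V] [Module ℝ V] (q : ℕ) : Type _ :=
  ∀ x : M, (TangentSpace I x) [⋀^Fin q]→ₗ[ℝ] V

variable {M}

/-- A field of linear maps on the tangent spaces, viewed as a 1-form. -/
def oneForm (a : ∀ x : M, TangentSpace I x →ₗ[ℝ] V) : DForm I M V 1 :=
  fun x => AlternatingMap.ofSubsingleton ℝ (TangentSpace I x) V 0 (a x)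

/-- The pullback of a form along a map `f : M → N`. -/
def pullback {q : ℕ} (f : M → N) (β : DForm I' N V q) : DForm I M V q :=
  fun x => (β (f x)).compLinearMap (mfderiv I I' f x).toLinearMap

variable {I}

/-- The interior product `ι_X β`, inserting the vector field `X` in the first slot. -/
def interior {q : ℕ} (X : ∀ x : M, TangentSpace I x) (β : DForm I M V (q + 1)) :
    DForm I M V q :=
  fun x => (β x).curryLeft (X x)

/-- The linear map on the tangent space at `x` underlying a 1-form. -/
def toLin (a : DForm I M V 1) (x : M) : TangentSpace I x →ₗ[ℝ] V :=
  (AlternatingMap.ofSubsingleton ℝ (TangentSpace I x) V (0 : Fin 1)).symm (a x)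

/-- The wedge product of two `V`-valued 1-forms combined with a bilinear form on `V`:
`(a ∧ b)(u, v) = a(u) · b(v) - a(v) · b(u)`. -/
def wedgeDot (B : LinearMap.BilinForm ℝ V) (a b : DForm I M V 1) : DForm I M ℝ 2 :=
  fun x =>
    { toFun := fun v =>
        B (toLin a x (v 0)) (toLin b x (v 1)) - B (toLin a x (v 1)) (toLin b x (v 0))
      map_update_add' := by
        intro _ m i u v
        fin_cases i <;> simp [Function.update] <;> ring
      map_update_smul' := by
        intro _ m i r u
        fin_cases i <;> simp [Function.update] <;> ring
      map_eq_zero_of_eq' := by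
        intro v i j hij hne
        have h : v 0 = v 1 := by
          fin_cases i <;> fin_cases j <;> simp_all
        rw [h, sub_self] }

end Forms

/-! ### Lie groups -/

section LieGroups

variable {E : Type*} [NormedAddCommGroup E] [NormedSpace ℝ E]
  {H : Type*} [TopologicalSpace H] (I : ModelWithCorners ℝ E H)
  {G : Type*} [TopologicalSpace G] [ChartedSpace H G] [Group G]

/-- The adjoint action `Ad g` on the Lie algebra `T₁G`: the derivative at `1` of `h ↦ g h g⁻¹`. -/
def Ad (g : G) : GroupLieAlgebra I G →L[ℝ] GroupLieAlgebra I G :=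
  mfderiv I I (fun h : G => g * h * g⁻¹) 1

variable (G) in
/-- An invariant inner product on the Lie algebra of `G`. -/
structure InvariantInnerProduct where
  /-- the underlying bilinear form -/
  form : LinearMap.BilinForm ℝ (GroupLieAlgebra I G)
  symm : ∀ u v, form u v = form v u
  pos : ∀ u, u ≠ 0 → 0 < form u u
  invariant : ∀ (g : G) (u v), form (Ad I g u) (Ad I g v) = form u v

/-- The derivative at `g` of `h ↦ g⁻¹ h`, with values in `T₁G`. -/
def leftTriv (g : G) : TangentSpace I g →L[ℝ] GroupLieAlgebra I G :=
  mfderiv I I (fun h : G => g⁻¹ * h) g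

/-- The derivative at `g` of `h ↦ h g⁻¹`, with values in `T₁G`. -/
def rightTriv (g : G) : TangentSpace I g →L[ℝ] GroupLieAlgebra I G :=
  mfderiv I I (fun h : G => h * g⁻¹) g

/-- The left-invariant Maurer-Cartan form `α`. -/
def leftMC : DForm I G (GroupLieAlgebra I G) 1 :=
  oneForm I fun g => (leftTriv I g).toLinearMap

/-- The right-invariant Maurer-Cartan form `ᾱ`. -/
def rightMC : DForm I G (GroupLieAlgebra I G) 1 :=
  oneForm I fun g => (rightTriv I g).toLinearMap

variable {I}

/-- The 2-form `Ω = α₁ · ᾱ₂` on `G × G`, where `α₁`, `ᾱ₂` are the pullbacks of the left- and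
right-invariant Maurer-Cartan forms along the first and second projections. -/
def Omega (B : InvariantInnerProduct I G) : DForm (I.prod I) (G × G) ℝ 2 :=
  wedgeDot B.form
    (pullback (I.prod I) I (Prod.fst : G × G → G) (leftMC I))
    (pullback (I.prod I) I (Prod.snd : G × G → G) (rightMC I))

/-- The 1-form `θ_η = η · (α + ᾱ)` on `G`. -/
def theta (B : InvariantInnerProduct I G) (η : GroupLieAlgebra I G) : DForm I G ℝ 1 :=
  fun x => (B.form η).compAlternatingMap (leftMC I x + rightMC I x)

variable (I) in
/-- The initial velocity of a curve `γ` in `G` with `γ 0 = 1`. -/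
def velocity (γ : ℝ → G) : GroupLieAlgebra I G :=
  mfderiv 𝓘(ℝ, ℝ) I γ 0 (1 : ℝ)

variable (I) in
/-- The Lie algebra of a closed subgroup `K` of `G`: the initial velocities of the smooth
one-parameter subgroups of `G` that stay in `K`. -/
def lieOfSubgroup (K : Subgroup G) : Set (GroupLieAlgebra I G) :=
  {η | ∃ γ : ℝ → G, ContMDiff 𝓘(ℝ, ℝ) I ∞ γ ∧ (∀ s t, γ (s + t) = γ s * γ t) ∧
    (∀ s, γ s ∈ K) ∧ velocity I γ = η}

/-! ### The forms and vector fields on `Y` -/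

variable (I) in
/-- The product model with corners of `Y = G^{2g}`. -/
abbrev repModel (g : ℕ) :
    ModelWithCorners ℝ (Fin (2 * g) → E) (ModelPi fun _ : Fin (2 * g) => H) :=
  ModelWithCorners.pi fun _ : Fin (2 * g) => I

/-- The 2-form `ω = ⟨c, E^*Ω⟩` on `Y`: the term `(a, b)` of the chain `c` contributes, with its
coefficient, the pullback of `Ω` along `y ↦ (y(a), y(b))`. -/
def omega (B : InvariantInnerProduct I G) (g : ℕ) : DForm (repModel I g) (RepSpace G g) ℝ 2 :=
  (chainC g).sum fun p n =>
    n • pullback (repModel I g) (I.prod I)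
      (fun y : RepSpace G g => (evalAt p.1 y, evalAt p.2 y)) (Omega B)

/-- The derivative at `1` of the orbit map `h ↦ h • y`. -/
def orbitDeriv {g : ℕ} (y : RepSpace G g) :
    GroupLieAlgebra I G →L[ℝ] TangentSpace (repModel I g) y :=
  mfderiv I (repModel I g) (fun h : G => conjAct h y) 1

/-- The vector field `η̃` on `Y` generated by `η`, i.e. `y ↦ d/ds|₀ exp(sη) • y`: its value at `y`
is the image of `η` under the derivative at `1` of the orbit map `h ↦ h • y`. -/
def genField {g : ℕ} (η : GroupLieAlgebra I G) (y : RepSpace G g) :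
    TangentSpace (repModel I g) y :=
  orbitDeriv y η

variable (I) in
/-- The (Zariski) tangent space at `y` of the level set of `ε_R` through `y`, which need not be a
submanifold: the kernel of the derivative of `ε_R`. -/
def levelTangent {g : ℕ} (y : RepSpace G g) : Submodule ℝ (TangentSpace (repModel I g) y) :=
  LinearMap.ker (mfderiv (repModel I g) I (epsR : RepSpace G g → G) y).toLinearMap

/-- The restriction of a form on `Y` to the level set of `ε_R` through `y`, at the point `y`. -/
def restrictLevel {g q : ℕ} (β : DForm (repModel I g) (RepSpace G g) ℝ q) (y : RepSpace G g) :
    (levelTangent I y) [⋀^Fin q]→ₗ[ℝ] ℝ :=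
  (β y).compLinearMap (levelTangent I y).subtype

end LieGroups

end FlatModuli

end

/-! Fix `η` and put `T w = ε_w^* θ_η`, where `ε_w` is evaluation at the word `w`. The contraction of
`E_{a,b}^* Ω` with the generated field equals `T (a * b) - T a - T b`, so `ι_η̃ ω` is the pairing of
the chain `c` with the coboundary of `T`.

The pointwise identity (`interior_pullback_Omega_apply`) rests on three facts. Evaluation is
equivariant, so `α` and `ᾱ` take the values `Ad a⁻¹ η - η` and `η - Ad a η` on the generated field.
On a product, `α` becomes `Ad b⁻¹ α_a + α_b` and `ᾱ` becomes `ᾱ_a + Ad a ᾱ_b`. The inner product is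
`Ad`-invariant.

The pairing with `c` (`chainC_sum`) is pure Fox calculus: `∑ᵢ ∂R/∂xᵢ (xᵢ - 1) = R - 1`, and each
`∂R/∂xᵢ` has augmentation zero because `R` is a product of commutators. Together with `T 1 = 0`,
only `T R = ε_R^* θ_η` survives.

Horizontality follows: `ε_R^* θ_η` factors through `dε_R`, hence vanishes on its kernel. -/

namespace FlatModuli

/-! ### Fox calculus and the pairing of the chain with coboundaries -/

section FoxSums

variable {ι A : Type*} [AddCommGroup A]

/-- The additive extension of a function on a group to its integral group ring. -/
noncomputable def groupRingLift {Γ : Type*} [Group Γ] (T : Γ → A) : MonoidAlgebra ℤ Γ →+ A where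
  toFun a := a.coeff.sum fun w n => n • T w
  map_zero' := by simp
  map_add' a b := by
    rw [MonoidAlgebra.coeff_add]
    exact Finsupp.sum_add_index' (by simp) fun w m n => add_smul m n (T w)

theorem groupRingLift_of {Γ : Type*} [Group Γ] (T : Γ → A) (w : Γ) :
    groupRingLift T (MonoidAlgebra.of ℤ Γ w) = T w := by
  change (Finsupp.single w (1 : ℤ)).sum (fun w n => n • T w) = T w
  simp

variable [DecidableEq ι]

theorem foxDeriv_one (i : ι) : foxDeriv i 1 = 0 := by
  simp [foxDeriv]

theorem foxDeriv_inv (i : ι) (w : FreeGroup ι) :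
    foxDeriv i w⁻¹ = -(MonoidAlgebra.of ℤ (FreeGroup ι) w⁻¹ * foxDeriv i w) := by
  have h := foxDeriv_mul i w⁻¹ w
  rw [inv_mul_cancel, foxDeriv_one] at h
  exact eq_neg_of_add_eq_zero_left h.symm

/-- The fundamental formula of the free differential calculus. -/
theorem sum_foxDeriv_mul [Fintype ι] (w : FreeGroup ι) :
    ∑ i, foxDeriv i w * (MonoidAlgebra.of ℤ (FreeGroup ι) (FreeGroup.of i) - 1) =
      MonoidAlgebra.of ℤ (FreeGroup ι) w - 1 := by
  have hmul : ∀ v w : FreeGroup ι,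
      (∑ i, foxDeriv i v * (MonoidAlgebra.of ℤ (FreeGroup ι) (FreeGroup.of i) - 1) =
        MonoidAlgebra.of ℤ (FreeGroup ι) v - 1) →
      (∑ i, foxDeriv i w * (MonoidAlgebra.of ℤ (FreeGroup ι) (FreeGroup.of i) - 1) =
        MonoidAlgebra.of ℤ (FreeGroup ι) w - 1) →
      ∑ i, foxDeriv i (v * w) * (MonoidAlgebra.of ℤ (FreeGroup ι) (FreeGroup.of i) - 1) =
        MonoidAlgebra.of ℤ (FreeGroup ι) (v * w) - 1 := by
    intro v w hv hw
    simp only [foxDeriv_mul, add_mul, mul_assoc, Finset.sum_add_distrib, ← Finset.mul_sum, hv, hw,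
      map_mul]
    -- The Fox product rule telescopes: `(v - 1) + v (w - 1) = v w - 1`.
    noncomm_ring
  induction w using FreeGroup.induction_on with
  | C1 => simp only [foxDeriv_one, zero_mul, Finset.sum_const_zero, map_one, sub_self]
  | of j => simp [foxDeriv_of]
  | inv_of j hj =>
    simp only [foxDeriv_inv, neg_mul, mul_assoc, Finset.sum_neg_distrib, ← Finset.mul_sum, hj]
    rw [mul_sub, ← map_mul, inv_mul_cancel, map_one, mul_one, neg_sub]
  | mul v w hv hw => exact hmul v w hv hw

/-- The sum of the coefficients of the Fox derivative, as a homomorphism. -/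
noncomputable def foxAugmentation (i : ι) (a : A) : FreeGroup ι →* Multiplicative A where
  toFun w := Multiplicative.ofAdd (groupRingLift (fun _ => a) (foxDeriv i w))
  map_one' := by simp [foxDeriv_one]
  map_mul' v w := by
    -- Left multiplication by `v` permutes the basis of group elements, so coefficient sums do not
    -- change and the Fox product rule becomes additivity.
    have h : ∀ b : MonoidAlgebra ℤ (FreeGroup ι), groupRingLift (fun _ => a)
        (MonoidAlgebra.of ℤ (FreeGroup ι) v * b) = groupRingLift (fun _ => a) b := by
      intro b
      induction b using MonoidAlgebra.induction_on with
      | of w => rw [← map_mul, groupRingLift_of, groupRingLift_of]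
      | add b c hb hc => rw [mul_add, map_add, map_add, hb, hc]
      | smul n b hb => rw [mul_smul_comm, map_zsmul, map_zsmul, hb]
    rw [foxDeriv_mul, map_add, h]
    rfl

/-- A homomorphism to an abelian group kills every commutator, and `relator g` is a product of
commutators. -/
theorem groupRingLift_const_foxDeriv_relator {g : ℕ} (i : Fin (2 * g)) (a : A) :
    groupRingLift (fun _ => a) (foxDeriv i (relator g)) = 0 := by
  have h : foxAugmentation i a (relator g) = 1 := by
    rw [relator, map_list_prod]
    refine List.prod_eq_one fun x hx => ?_
    simp only [List.map_ofFn, List.mem_ofFn, Function.comp_apply] at hx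
    obtain ⟨j, rfl⟩ := hx
    simp only [groupComm, map_mul, map_inv]
    rw [mul_right_comm, mul_inv_cancel_right, mul_inv_cancel]
  exact h

/-- After linear extension of `T`, the first two terms sum to `T` of `∑ᵢ ∂R/∂xᵢ (xᵢ - 1) = R - 1`,
while the terms `T xᵢ` are weighted by the vanishing augmentations of `∂R/∂xᵢ`. -/
theorem chainC_sum {g : ℕ} (T : FreeGroup (Fin (2 * g)) → A) (h1 : T 1 = 0) :
    ((chainC g).sum fun p n => n • (T (p.1 * p.2) - T p.1 - T p.2)) = T (relator g) := by
  have hr : ∀ (v : FreeGroup (Fin (2 * g))) (a : MonoidAlgebra ℤ (FreeGroup (Fin (2 * g)))),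
      groupRingLift (fun w => T (w * v)) a =
        groupRingLift T (a * MonoidAlgebra.of ℤ (FreeGroup (Fin (2 * g))) v) := by
    intro v a
    induction a using MonoidAlgebra.induction_on with
    | of w => rw [← map_mul, groupRingLift_of, groupRingLift_of]
    | add b c hb hc => rw [add_mul, map_add, map_add, hb, hc]
    | smul n b hb => rw [smul_mul_assoc, map_zsmul, map_zsmul, hb]
  have hi : ∀ i : Fin (2 * g),
      (((foxDeriv i (relator g)).coeff.mapDomain fun w => (w, FreeGroup.of i)).sum
        fun p n => n • (T (p.1 * p.2) - T p.1 - T p.2)) =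
      groupRingLift T (foxDeriv i (relator g) *
        (MonoidAlgebra.of ℤ (FreeGroup (Fin (2 * g))) (FreeGroup.of i) - 1)) := by
    intro i
    rw [Finsupp.sum_mapDomain_index (by simp) (fun _ _ _ => add_smul _ _ _)]
    -- The zero introduced here is the augmentation of `∂R/∂xᵢ` times `T xᵢ`, which supplies the
    -- third term of the coboundary.
    rw [mul_sub, mul_one, map_sub, ← hr, ← sub_zero (_ - _),
      ← groupRingLift_const_foxDeriv_relator i (T (FreeGroup.of i))]
    simp only [smul_sub, Finsupp.sum_sub]
    rfl
  rw [chainC, ← Finsupp.sum_finsetSum_index (by simp) (fun _ _ _ => add_smul _ _ _)]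
  rw [Finset.sum_congr rfl fun i _ => hi i, ← map_sum, sum_foxDeriv_mul, map_sub, groupRingLift_of,
    ← map_one (MonoidAlgebra.of ℤ (FreeGroup (Fin (2 * g)))), groupRingLift_of, h1, sub_zero]

end FoxSums

/-! ### Differentiability into and out of a finite power of a manifold -/

section Pi
variable {ι : Type*} [Fintype ι] {E : Type*} [NormedAddCommGroup E] [NormedSpace ℝ E]
  {H : Type*} [TopologicalSpace H] {I : ModelWithCorners ℝ E H}
  {G : Type*} [TopologicalSpace G] [ChartedSpace H G]
  {E' : Type*} [NormedAddCommGroup E'] [NormedSpace ℝ E']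
  {H' : Type*} [TopologicalSpace H'] {J : ModelWithCorners ℝ E' H'}
  {M : Type*} [TopologicalSpace M] [ChartedSpace H' M]

theorem mdifferentiableAt_pi_apply (i : ι) (y : ι → G) :
    MDifferentiableAt (ModelWithCorners.pi fun _ : ι => I) I (fun z : ι → G => z i) y := by
  rw [mdifferentiableAt_iff]
  refine ⟨(continuous_apply i).continuousAt, ?_⟩
  have hd : DifferentiableWithinAt ℝ (fun u : ι → E => u i)
      (Set.range (ModelWithCorners.pi fun _ : ι => I))
      ((extChartAt (ModelWithCorners.pi fun _ : ι => I) y) y) :=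
    (differentiableAt_apply i _).differentiableWithinAt
  refine hd.congr_of_eventuallyEq_of_mem ?_ (Set.mem_range_self _)
  -- Product charts act componentwise, so the map read in charts is the linear coordinate
  -- projection, but only on the chart target.
  filter_upwards [extChartAt_target_mem_nhdsWithin (I := ModelWithCorners.pi fun _ : ι => I) y]
    with u hu
  exact congrFun ((extChartAt (ModelWithCorners.pi fun _ : ι => I) y).right_inv hu) i

theorem mdifferentiableAt_pi {f : M → ι → G} {x : M}
    (hf : ∀ i, MDifferentiableAt J I (fun z => f z i) x) :
    MDifferentiableAt J (ModelWithCorners.pi fun _ : ι => I) f x := by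
  rw [mdifferentiableAt_iff]
  refine ⟨continuousAt_pi.2 fun i => (hf i).continuousAt, ?_⟩
  exact differentiableWithinAt_pi.2 fun i => ((mdifferentiableAt_iff _ _).1 (hf i)).2

end Pi

/-! ### Maurer–Cartan forms on products and on conjugation orbits -/

section LieCalculus

variable {E : Type*} [NormedAddCommGroup E] [NormedSpace ℝ E]
  {H : Type*} [TopologicalSpace H] {I : ModelWithCorners ℝ E H}
  {G : Type*} [TopologicalSpace G] [ChartedSpace H G] [Group G] [LieGroup I ∞ G]
  {E' : Type*} [NormedAddCommGroup E'] [NormedSpace ℝ E']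
  {H' : Type*} [TopologicalSpace H'] {J : ModelWithCorners ℝ E' H'}
  {M : Type*} [TopologicalSpace M] [ChartedSpace H' M]

theorem mdifferentiableAt_groupMul (p : G × G) :
    MDifferentiableAt (I.prod I) I (fun q : G × G => q.1 * q.2) p :=
  (contMDiff_mul I ∞).mdifferentiable (by simp) p

theorem mdifferentiableAt_groupInv (a : G) : MDifferentiableAt I I (fun z : G => z⁻¹) a :=
  (contMDiff_inv I ∞).mdifferentiable (by simp) a

theorem mdifferentiableAt_fun_groupMul {f h : M → G} {x : M} (hf : MDifferentiableAt J I f x)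
    (hh : MDifferentiableAt J I h x) : MDifferentiableAt J I (fun z => f z * h z) x :=
  (mdifferentiableAt_groupMul (I := I) (f x, h x)).comp x (hf.prodMk hh)

theorem mdifferentiableAt_fun_groupInv {f : M → G} {x : M} (hf : MDifferentiableAt J I f x) :
    MDifferentiableAt J I (fun z => (f z)⁻¹) x :=
  (mdifferentiableAt_groupInv (I := I) (f x)).comp x hf

theorem mdifferentiableAt_const_groupMul {f : M → G} {x : M} (a : G)
    (hf : MDifferentiableAt J I f x) : MDifferentiableAt J I (fun z => a * f z) x :=
  mdifferentiableAt_fun_groupMul mdifferentiableAt_const hf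

theorem mdifferentiableAt_groupMul_const {f : M → G} {x : M} (a : G)
    (hf : MDifferentiableAt J I f x) : MDifferentiableAt J I (fun z => f z * a) x :=
  mdifferentiableAt_fun_groupMul hf mdifferentiableAt_const

theorem mdifferentiableAt_groupConj {f : M → G} {x : M} (a : G)
    (hf : MDifferentiableAt J I f x) : MDifferentiableAt J I (fun z => a * f z * a⁻¹) x :=
  mdifferentiableAt_groupMul_const a⁻¹ (mdifferentiableAt_const_groupMul a hf)

/-- The Leibniz rule for a product of maps into a Lie group. -/
theorem mfderiv_groupMul_apply {f h : M → G} {x : M} (hf : MDifferentiableAt J I f x)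
    (hh : MDifferentiableAt J I h x) (v : TangentSpace J x) :
    mfderiv J I (fun z => f z * h z) x v =
      mfderiv J I (fun z => f z * h x) x v + mfderiv J I (fun z => f x * h z) x v := by
  have hm := mdifferentiableAt_groupMul (I := I) (f x, h x)
  have hl : MDifferentiableAt I I (fun z : G => z * h x) (f x) :=
    mdifferentiableAt_groupMul_const _ mdifferentiableAt_id
  have hr : MDifferentiableAt I I (fun z : G => f x * z) (h x) :=
    mdifferentiableAt_const_groupMul _ mdifferentiableAt_id
  have e := mfderiv_comp_apply (I := J) (I' := I.prod I) (I'' := I) x hm (hf.prodMk hh) v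
  rw [mfderiv_prodMk hf hh, mfderiv_prod_eq_add_apply hm] at e
  refine Eq.trans e ?_
  have el := mfderiv_comp_apply (I := J) (I' := I) (I'' := I) x hl hf v
  have er := mfderiv_comp_apply (I := J) (I' := I) (I'' := I) x hr hh v
  exact (congrArg₂ (fun a b : E => a + b) el er).symm

variable (I J) in
/-- The value of the derivative of a map, as a vector of the model space of the target. -/
noncomputable def modelDeriv (f : M → G) (x : M) (v : TangentSpace J x) : E := mfderiv J I f x v

/-- The differential of multiplication at `(1, 1)` is addition. Values in the model space avoid
transport between tangent spaces at equal but syntactically different base points. -/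
theorem modelDeriv_eq_add_of_eq_mul {k f h : M → G} {x : M} (hk : ∀ z, k z = f z * h z)
    (hf : MDifferentiableAt J I f x) (hh : MDifferentiableAt J I h x) (hf1 : f x = 1)
    (hh1 : h x = 1) (v : TangentSpace J x) :
    modelDeriv I J k x v = modelDeriv I J f x v + modelDeriv I J h x v := by
  obtain rfl : k = fun z => f z * h z := funext hk
  refine Eq.trans (mfderiv_groupMul_apply hf hh v) ?_
  have e1 : (fun z => f z * h x) = f := by simp [hh1]
  have e2 : (fun z => f x * h z) = h := by simp [hf1]
  refine congrArg₂ (fun a b : E => a + b) ?_ ?_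
  · rw [e1]; rfl
  · rw [e2]; rfl

theorem leftTriv_mfderiv {f : M → G} {x : M} (hf : MDifferentiableAt J I f x)
    (v : TangentSpace J x) :
    leftTriv I (f x) (mfderiv J I f x v) =
      modelDeriv I J (fun z => (f x)⁻¹ * f z) x v :=
  (mfderiv_comp_apply (I := J) (I' := I) (I'' := I) (g := fun z : G => (f x)⁻¹ * z) x
    (mdifferentiableAt_const_groupMul _ mdifferentiableAt_id) hf v).symm

theorem rightTriv_mfderiv {f : M → G} {x : M} (hf : MDifferentiableAt J I f x)
    (v : TangentSpace J x) :
    rightTriv I (f x) (mfderiv J I f x v) =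
      modelDeriv I J (fun z => f z * (f x)⁻¹) x v :=
  (mfderiv_comp_apply (I := J) (I' := I) (I'' := I) (g := fun z : G => z * (f x)⁻¹) x
    (mdifferentiableAt_groupMul_const _ mdifferentiableAt_id) hf v).symm

theorem Ad_mfderiv {f : M → G} {x : M} (a : G) (hf : MDifferentiableAt J I f x) (h1 : f x = 1)
    (v : TangentSpace J x) :
    Ad I a (modelDeriv I J f x v : E) = modelDeriv I J (fun z => a * f z * a⁻¹) x v :=
  (mfderiv_comp_apply_of_eq (I := J) (I' := I) (I'' := I) (g := fun z : G => a * z * a⁻¹) x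
    (mdifferentiableAt_groupConj a mdifferentiableAt_id) hf h1 v).symm

theorem Ad_mul_apply (a b : G) (u : GroupLieAlgebra I G) :
    Ad I (a * b) u = Ad I a (Ad I b u) := by
  have h := Ad_mfderiv (J := I) a
    (mdifferentiableAt_groupConj (I := I) b (mdifferentiableAt_id (x := (1 : G)))) (by simp) u
  refine Eq.trans ?_ h.symm
  have hfun : (fun z : G => a * b * z * (a * b)⁻¹) = fun z => a * (b * id z * b⁻¹) * a⁻¹ := by
    funext z; simp [mul_assoc]
  rw [Ad, hfun]
  rfl

omit [LieGroup I ∞ G] in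
theorem Ad_one_apply (u : GroupLieAlgebra I G) : Ad I (1 : G) u = u := by
  have h : (fun z : G => 1 * z * 1⁻¹) = id := by ext z; simp
  simp only [Ad]
  rw [h, mfderiv_id]
  rfl

theorem Ad_inv_apply_Ad (a : G) (u : GroupLieAlgebra I G) : Ad I a⁻¹ (Ad I a u) = u := by
  rw [← Ad_mul_apply, inv_mul_cancel, Ad_one_apply]

/-- With `F z = (f x)⁻¹ * f z` and `K z = (h x)⁻¹ * h z`, the left translate of `f z * h z` to `1`
is `(h x)⁻¹ * F z * h x` times `K z`. -/
theorem leftTriv_groupMul {f h : M → G} {x : M} (hf : MDifferentiableAt J I f x)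
    (hh : MDifferentiableAt J I h x) (v : TangentSpace J x) :
    leftTriv I (f x * h x) (mfderiv J I (fun z => f z * h z) x v) =
      Ad I (h x)⁻¹ (leftTriv I (f x) (mfderiv J I f x v)) +
        leftTriv I (h x) (mfderiv J I h x v) := by
  have hF := mdifferentiableAt_const_groupMul (f x)⁻¹ hf
  have hK := mdifferentiableAt_const_groupMul (h x)⁻¹ hh
  rw [leftTriv_mfderiv hh v, leftTriv_mfderiv hf v, Ad_mfderiv _ hF (by simp)]
  refine Eq.trans (leftTriv_mfderiv (mdifferentiableAt_fun_groupMul hf hh) v) ?_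
  exact modelDeriv_eq_add_of_eq_mul (k := fun z => (f x * h x)⁻¹ * (f z * h z)) (fun z => by group)
    (mdifferentiableAt_groupConj (h x)⁻¹ hF) hK
    (by simp) (by simp) v

/-- Mirror image: now `h z * (h x)⁻¹` is conjugated by `f x`. -/
theorem rightTriv_groupMul {f h : M → G} {x : M} (hf : MDifferentiableAt J I f x)
    (hh : MDifferentiableAt J I h x) (v : TangentSpace J x) :
    rightTriv I (f x * h x) (mfderiv J I (fun z => f z * h z) x v) =
      rightTriv I (f x) (mfderiv J I f x v) +
        Ad I (f x) (rightTriv I (h x) (mfderiv J I h x v)) := by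
  have hF := mdifferentiableAt_groupMul_const (f x)⁻¹ hf
  have hK := mdifferentiableAt_groupMul_const (h x)⁻¹ hh
  rw [rightTriv_mfderiv hh v, rightTriv_mfderiv hf v, Ad_mfderiv _ hK (by simp)]
  refine Eq.trans (rightTriv_mfderiv (mdifferentiableAt_fun_groupMul hf hh) v) ?_
  exact modelDeriv_eq_add_of_eq_mul (k := fun z => (f z * h z) * (f x * h x)⁻¹) (fun z => by group)
    hF (mdifferentiableAt_groupConj (f x) hK)
    (by simp) (by simp) v

/-- Differentiate `1 = z * z⁻¹` at `1`. -/
theorem modelDeriv_groupInv_one (u : GroupLieAlgebra I G) :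
    modelDeriv I I (fun z : G => z⁻¹) 1 u = (-u : E) := by
  have e := modelDeriv_eq_add_of_eq_mul (J := I) (k := fun _ : G => 1) (fun z => by simp)
    (mdifferentiableAt_id (I := I) (x := (1 : G))) (mdifferentiableAt_groupInv (I := I) 1)
    rfl inv_one u
  have h0 : modelDeriv I I (fun _ : G => (1 : G)) 1 u = 0 := by rw [modelDeriv, mfderiv_const]; rfl
  have h1 : modelDeriv I I (id : G → G) 1 u = u := by rw [modelDeriv, mfderiv_id]; rfl
  rw [h0, h1] at e
  exact (neg_eq_of_add_eq_zero_right e.symm).symm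

theorem mdifferentiableAt_conjOrbit (a b : G) :
    MDifferentiableAt I I (fun h : G => h * a * h⁻¹) b :=
  mdifferentiableAt_fun_groupMul (mdifferentiableAt_groupMul_const a mdifferentiableAt_id)
    (mdifferentiableAt_groupInv b)

/-- Factor `a⁻¹ * (h * a * h⁻¹)` as `(a⁻¹ * h * a) * h⁻¹`, both factors being `1` at `h = 1`. -/
theorem leftTriv_conjOrbit (a : G) (η : GroupLieAlgebra I G) :
    leftTriv I a (modelDeriv I I (fun h : G => h * a * h⁻¹) 1 η : E) = Ad I a⁻¹ η - η := by
  have hd := mfderiv_comp_apply_of_eq (I := I) (I' := I) (I'' := I)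
    (g := fun z : G => a⁻¹ * z) (f := fun h : G => h * a * h⁻¹) (y := a) 1
    (mdifferentiableAt_const_groupMul _ mdifferentiableAt_id) (mdifferentiableAt_conjOrbit a 1)
    (by simp) η
  refine Eq.trans hd.symm ?_
  refine Eq.trans (modelDeriv_eq_add_of_eq_mul (k := fun h => a⁻¹ * (h * a * h⁻¹))
    (f := fun h => a⁻¹ * h * a⁻¹⁻¹)
    (fun h => by simp [mul_assoc])
    (mdifferentiableAt_groupConj a⁻¹ mdifferentiableAt_id) (mdifferentiableAt_groupInv 1)
    (by simp) (by simp) η) ?_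
  rw [modelDeriv_groupInv_one]
  exact (sub_eq_add_neg (Ad I a⁻¹ η : E) (η : E)).symm

/-- Factor `h * a * h⁻¹ * a⁻¹` as `h * (a * h⁻¹ * a⁻¹)`. -/
theorem rightTriv_conjOrbit (a : G) (η : GroupLieAlgebra I G) :
    rightTriv I a (modelDeriv I I (fun h : G => h * a * h⁻¹) 1 η : E) = η - Ad I a η := by
  have hd := mfderiv_comp_apply_of_eq (I := I) (I' := I) (I'' := I)
    (g := fun z : G => z * a⁻¹) (f := fun h : G => h * a * h⁻¹) (y := a) 1
    (mdifferentiableAt_groupMul_const _ mdifferentiableAt_id) (mdifferentiableAt_conjOrbit a 1)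
    (by simp) η
  refine Eq.trans hd.symm ?_
  have hi := mdifferentiableAt_groupInv (I := I) (1 : G)
  refine Eq.trans (modelDeriv_eq_add_of_eq_mul (k := fun h => h * a * h⁻¹ * a⁻¹) (f := id) (fun h => by simp [mul_assoc])
    mdifferentiableAt_id (mdifferentiableAt_groupConj a hi) rfl (by simp) η) ?_
  have h1 : modelDeriv I I (id : G → G) 1 η = η := by rw [modelDeriv, mfderiv_id]; rfl
  have h2 : Ad I a (-η) = -Ad I a η := map_neg (Ad I a) η
  rw [← Ad_mfderiv a hi inv_one, modelDeriv_groupInv_one, h1]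
  exact (congrArg (fun w : GroupLieAlgebra I G => η + w) h2).trans (sub_eq_add_neg (η : E) (Ad I a η : E)).symm

end LieCalculus

/-! ### Contraction of `ω` with generated fields -/

section RepSpaceCalculus

theorem conjAct_one {G : Type*} [Group G] {g : ℕ} (y : RepSpace G g) : conjAct 1 y = y := by
  funext i; simp [conjAct]

variable {E : Type*} [NormedAddCommGroup E] [NormedSpace ℝ E]
  {H : Type*} [TopologicalSpace H] {I : ModelWithCorners ℝ E H}
  {G : Type*} [TopologicalSpace G] [ChartedSpace H G] [Group G]

theorem pullback_theta_apply {g : ℕ} (B : InvariantInnerProduct I G) (η : GroupLieAlgebra I G)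
    (f : RepSpace G g → G) (y : RepSpace G g) (v : Fin 1 → TangentSpace (repModel I g) y) :
    pullback (repModel I g) I f (theta B η) y v =
      B.form η (leftTriv I (f y) (mfderiv (repModel I g) I f y (v 0)) +
        rightTriv I (f y) (mfderiv (repModel I g) I f y (v 0))) :=
  rfl

variable [LieGroup I ∞ G]

theorem mdifferentiableAt_evalAt {g : ℕ} (w : FreeGroup (Fin (2 * g))) (y : RepSpace G g) :
    MDifferentiableAt (repModel I g) I (fun z : RepSpace G g => evalAt w z) y := by
  have hof : ∀ j, MDifferentiableAt (repModel I g) I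
      (fun z : RepSpace G g => evalAt (FreeGroup.of j) z) y := by
    intro j
    simp only [evalAt, FreeGroup.lift_apply_of]
    exact mdifferentiableAt_pi_apply j y
  induction w using FreeGroup.induction_on with
  | C1 =>
    simp only [evalAt, map_one]
    exact mdifferentiableAt_const
  | of j => exact hof j
  | inv_of j hj =>
    have := mdifferentiableAt_fun_groupInv (hof j)
    simpa only [evalAt, map_inv] using this
  | mul v w hv hw =>
    have := mdifferentiableAt_fun_groupMul hv hw
    simpa only [evalAt, map_mul] using this

theorem mdifferentiableAt_conjAct {g : ℕ} (y : RepSpace G g) (a : G) :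
    MDifferentiableAt I (repModel I g) (fun h : G => conjAct h y) a :=
  mdifferentiableAt_pi fun i => mdifferentiableAt_conjOrbit (y i) a

/-- Evaluation at a word is equivariant for conjugation, so it carries orbit maps of `RepSpace G g`
to orbit maps of `G`. -/
theorem mfderiv_evalAt_genField {g : ℕ} (w : FreeGroup (Fin (2 * g))) (y : RepSpace G g)
    (η : GroupLieAlgebra I G) :
    (mfderiv (repModel I g) I (fun z : RepSpace G g => evalAt w z) y (genField η y) : E) =
      modelDeriv I I (fun h : G => h * evalAt w y * h⁻¹) 1 η := by
  have h := mfderiv_comp_apply_of_eq (I := I) (I' := repModel I g) (I'' := I)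
    (g := fun z : RepSpace G g => evalAt w z) (f := fun h : G => conjAct h y) (y := y) 1
    (mdifferentiableAt_evalAt w y) (mdifferentiableAt_conjAct y 1) (conjAct_one y) η
  refine Eq.trans h.symm ?_
  have hfun : ((fun z : RepSpace G g => evalAt w z) ∘ fun h : G => conjAct h y) =
      fun h : G => h * evalAt w y * h⁻¹ := funext fun h => evalAt_conjAct h w y
  rw [hfun]
  rfl

theorem leftTriv_genField {g : ℕ} (w : FreeGroup (Fin (2 * g))) (y : RepSpace G g)
    (η : GroupLieAlgebra I G) :
    leftTriv I (evalAt w y)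
      (mfderiv (repModel I g) I (fun z : RepSpace G g => evalAt w z) y (genField η y)) =
      Ad I (evalAt w y)⁻¹ η - η :=
  (congrArg (leftTriv I (evalAt w y)) (mfderiv_evalAt_genField w y η)).trans
    (leftTriv_conjOrbit _ η)

theorem rightTriv_genField {g : ℕ} (w : FreeGroup (Fin (2 * g))) (y : RepSpace G g)
    (η : GroupLieAlgebra I G) :
    rightTriv I (evalAt w y)
      (mfderiv (repModel I g) I (fun z : RepSpace G g => evalAt w z) y (genField η y)) =
      η - Ad I (evalAt w y) η :=
  (congrArg (rightTriv I (evalAt w y)) (mfderiv_evalAt_genField w y η)).trans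
    (rightTriv_conjOrbit _ η)

theorem pullback_Omega_apply {g : ℕ} (B : InvariantInnerProduct I G)
    (a b : FreeGroup (Fin (2 * g))) (y : RepSpace G g)
    (v : Fin 2 → TangentSpace (repModel I g) y) :
    pullback (repModel I g) (I.prod I)
        (fun y : RepSpace G g => (evalAt a y, evalAt b y)) (Omega B) y v =
      B.form (leftTriv I (evalAt a y)
          (mfderiv (repModel I g) I (fun z : RepSpace G g => evalAt a z) y (v 0)))
        (rightTriv I (evalAt b y)
          (mfderiv (repModel I g) I (fun z : RepSpace G g => evalAt b z) y (v 1))) -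
      B.form (leftTriv I (evalAt a y)
          (mfderiv (repModel I g) I (fun z : RepSpace G g => evalAt a z) y (v 1)))
        (rightTriv I (evalAt b y)
          (mfderiv (repModel I g) I (fun z : RepSpace G g => evalAt b z) y (v 0))) := by
  have ha : ∀ u : TangentSpace (repModel I g) y,
      toLin (pullback (I.prod I) I (Prod.fst : G × G → G) (leftMC I)) (evalAt a y, evalAt b y)
        (mfderiv (repModel I g) (I.prod I)
          (fun y : RepSpace G g => (evalAt a y, evalAt b y)) y u) =
      leftTriv I (evalAt a y)
          (mfderiv (repModel I g) I (fun z : RepSpace G g => evalAt a z) y u) := by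
    intro u
    change leftTriv I (evalAt a y) (mfderiv (I.prod I) I Prod.fst (evalAt a y, evalAt b y)
      (mfderiv (repModel I g) (I.prod I)
          (fun y : RepSpace G g => (evalAt a y, evalAt b y)) y u)) = _
    rw [mfderiv_prodMk (mdifferentiableAt_evalAt a y) (mdifferentiableAt_evalAt b y), mfderiv_fst]
    rfl
  have hb : ∀ u : TangentSpace (repModel I g) y,
      toLin (pullback (I.prod I) I (Prod.snd : G × G → G) (rightMC I)) (evalAt a y, evalAt b y)
        (mfderiv (repModel I g) (I.prod I)
          (fun y : RepSpace G g => (evalAt a y, evalAt b y)) y u) =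
      rightTriv I (evalAt b y)
          (mfderiv (repModel I g) I (fun z : RepSpace G g => evalAt b z) y u) := by
    intro u
    change rightTriv I (evalAt b y) (mfderiv (I.prod I) I Prod.snd (evalAt a y, evalAt b y)
      (mfderiv (repModel I g) (I.prod I)
          (fun y : RepSpace G g => (evalAt a y, evalAt b y)) y u)) = _
    rw [mfderiv_prodMk (mdifferentiableAt_evalAt a y) (mdifferentiableAt_evalAt b y), mfderiv_snd]
    rfl
  rw [← ha, ← ha, ← hb, ← hb]
  rfl

theorem form_Ad_inv_left (B : InvariantInnerProduct I G) (a : G) (u v : GroupLieAlgebra I G) :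
    B.form (Ad I a⁻¹ u) v = B.form u (Ad I a v) := by
  rw [← B.invariant a⁻¹ u (Ad I a v), Ad_inv_apply_Ad]

theorem form_Ad_right (B : InvariantInnerProduct I G) (a : G) (u v : GroupLieAlgebra I G) :
    B.form u (Ad I a v) = B.form v (Ad I a⁻¹ u) := by
  rw [← form_Ad_inv_left, B.symm]

/-- The contraction of `E_{a,b}^* Ω` with a generated vector field is the coboundary of
`w ↦ ε_w^* θ_η`, evaluated at `(a, b)`. -/
theorem interior_pullback_Omega_apply {g : ℕ} (B : InvariantInnerProduct I G)
    (η : GroupLieAlgebra I G) (a b : FreeGroup (Fin (2 * g))) (y : RepSpace G g)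
    (v : Fin 1 → TangentSpace (repModel I g) y) :
    interior (genField η) (pullback (repModel I g) (I.prod I)
        (fun y : RepSpace G g => (evalAt a y, evalAt b y)) (Omega B)) y v =
      pullback (repModel I g) I (fun z : RepSpace G g => evalAt (a * b) z) (theta B η) y v -
      pullback (repModel I g) I (fun z : RepSpace G g => evalAt a z) (theta B η) y v -
      pullback (repModel I g) I (fun z : RepSpace G g => evalAt b z) (theta B η) y v := by
  have hab : (fun z : RepSpace G g => evalAt (a * b) z) = fun z => evalAt a z * evalAt b z := by
    funext z; simp [evalAt]
  rw [hab, pullback_theta_apply, pullback_theta_apply, pullback_theta_apply,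
    leftTriv_groupMul (mdifferentiableAt_evalAt a y) (mdifferentiableAt_evalAt b y),
    rightTriv_groupMul (mdifferentiableAt_evalAt a y) (mdifferentiableAt_evalAt b y)]
  refine Eq.trans (pullback_Omega_apply B a b y (Matrix.vecCons (genField η y) v)) ?_
  simp only [Matrix.cons_val_zero, Matrix.cons_val_one, leftTriv_genField, rightTriv_genField]
  simp only [map_add, map_sub, LinearMap.sub_apply]
  -- Invariance trades `Ad a⁻¹ η · ᾱ_b` for `η · Ad a ᾱ_b`, and `η · Ad b⁻¹ α_a` for `α_a · Ad b η`.
  rw [form_Ad_inv_left, form_Ad_right B (evalAt b y)⁻¹ η, inv_inv, B.symm _ η]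
  ring

theorem interior_genField_omega (B : InvariantInnerProduct I G) (g : ℕ)
    (η : GroupLieAlgebra I G) :
    interior (genField η) (omega B g) = pullback (repModel I g) I epsR (theta B η) := by
  funext y
  ext v
  -- Contraction and evaluation at fixed `y`, `v` form an additive functional, so they pass through
  -- the sum over the chain.
  let ev : DForm (repModel I g) (RepSpace G g) ℝ 2 →+ ℝ :=
    { toFun := fun β => interior (genField η) β y v
      map_zero' := rfl
      map_add' := fun _ _ => rfl }
  have h := chainC_sum (g := g) (fun w => pullback (repModel I g) I
    (fun z : RepSpace G g => evalAt w z) (theta B η) y v) (by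
      have h1 : (fun z : RepSpace G g => evalAt 1 z) = fun _ => (1 : G) := by
        funext z; simp [evalAt]
      rw [h1, pullback_theta_apply, mfderiv_const]
      simp)
  refine Eq.trans ?_ h
  change ev (omega B g) = _
  rw [omega, map_finsuppSum]
  refine Finsupp.sum_congr fun p _ => ?_
  rw [map_zsmul]
  exact congrArg _ (interior_pullback_Omega_apply B η p.1 p.2 y v)

/-- By equivariance `dε_R` sends the generated vector to the velocity of `s ↦ γ s * t * (γ s)⁻¹`,
which is constant when `γ` stays in the centralizer. -/
theorem genField_mem_levelTangent {g : ℕ} {t : G} {η : GroupLieAlgebra I G}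
    (hη : η ∈ lieOfSubgroup I (Subgroup.centralizer {t})) {y : RepSpace G g}
    (hy : y ∈ levelSet g t) : genField η y ∈ levelTangent I y := by
  obtain ⟨γ, hγ, hadd, hmem, rfl⟩ := hη
  have h0 : γ 0 = 1 := by simpa using hadd 0 0
  have ht : evalAt (relator g) y = t := hy
  change (mfderiv (repModel I g) I (fun z : RepSpace G g => evalAt (relator g) z) y
    (genField (velocity I γ) y) : E) = 0
  rw [mfderiv_evalAt_genField, ht]
  have h := mfderiv_comp_apply_of_eq (I := 𝓘(ℝ, ℝ)) (I' := I) (I'' := I)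
    (g := fun h : G => h * t * h⁻¹) (f := γ) (y := 1) 0 (mdifferentiableAt_conjOrbit t 1)
    (hγ.mdifferentiable (by simp) 0) h0 (1 : ℝ)
  refine Eq.trans h.symm ?_
  have hfun : ((fun h : G => h * t * h⁻¹) ∘ γ) = fun _ => t := by
    funext s
    change γ s * t * (γ s)⁻¹ = t
    rw [Subgroup.mem_centralizer_singleton_iff.mp (hmem s), mul_inv_cancel_right]
  rw [hfun, mfderiv_const]
  rfl

end RepSpaceCalculus
end FlatModuli

/-! ### The contraction identity and horizontality on level sets -/

theorem propositionp5
    {E : Type*} [NormedAddCommGroup E] [NormedSpace ℝ E] [FiniteDimensional ℝ E]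
    {H : Type*} [TopologicalSpace H] (I : ModelWithCorners ℝ E H) [I.Boundaryless]
    {G : Type*} [TopologicalSpace G] [ChartedSpace H G] [Group G] [LieGroup I ∞ G]
    [CompactSpace G] [ConnectedSpace G]
    (B : FlatModuli.InvariantInnerProduct I G) (g : ℕ) :
    (∀ η : GroupLieAlgebra I G,
      FlatModuli.interior (FlatModuli.genField η) (FlatModuli.omega B g) =
        FlatModuli.pullback (FlatModuli.repModel I g) I FlatModuli.epsR
          (FlatModuli.theta B η)) ∧
    (∀ (t : G), ∀ η ∈ FlatModuli.lieOfSubgroup I (Subgroup.centralizer {t}),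
      ∀ y ∈ FlatModuli.levelSet g t,
        FlatModuli.genField η y ∈ FlatModuli.levelTangent I y ∧
        FlatModuli.restrictLevel
          (FlatModuli.interior (FlatModuli.genField η) (FlatModuli.omega B g)) y = 0) := by
  refine ⟨fun η => FlatModuli.interior_genField_omega B g η, fun t η hη y hy =>
    ⟨FlatModuli.genField_mem_levelTangent hη hy, ?_⟩⟩
  rw [FlatModuli.interior_genField_omega]
  ext v
  -- The pulled-back form sees `v` only through `dε_R`, whose kernel is the level tangent space.
  have hv : mfderiv (FlatModuli.repModel I g) I (FlatModuli.epsR : FlatModuli.RepSpace G g → G) y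
      (v 0).1 = 0 := (v 0).2
  refine Eq.trans (FlatModuli.pullback_theta_apply B η FlatModuli.epsR y fun i => (v i).1) ?_
  rw [hv]
  simp
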